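/- Conventions. All graphs are finite, directed and simple: no loops and no multiple edges, but both $u\to v$ and $v\to u$ may be edges. A graph is *irreducible* if there is a directed path from $u$ to $v$ for all vertices $u,v$, and *essential* if every vertex has in-degree and out-degree at least $1$. A *set-equipped graph* $(G,\mathcal S)$ is a graph $G$ with a family $\mathcal S=(S_v)_{v\in V(G)}$ of nonempty sets of positive integers. Its *$\mathcal S$-graph shift* $X(G,\mathcal S)\subseteq V(G)^{\mathbb Z}$ is the closure (product topology, $V(G)$ discrete) of the set of all bi-infinite strings $$\cdots u_{-1}^{n_{-1}}u_0^{n_0}u_1^{n_1}\cdots,\qquad u_i\in V(G),\ n_i\in S_{u_i},\ (u_i,u_{i+1})\in E(G)\ \text{ for all } i\in\mathbb Z,$$ where the origin of $\mathbb Z$ may lie at any place of the string. Set-equipped graphs are assumed to be essential, so that every letter of the alphabet $V(G)$ occurs in $X(G,\mathcal S)$; an *$\mathcal S$-graph shift on $q$ letters* is a shift $X(H,\mathcal T)$, where $(H,\mathcal T)$ is a set-equipped graph, $H$ is essential and $H$ has exactly $q$ vertices. Two shifts are *conjugate* if there is a homeomorphism between them that commutes with the shift maps. **Proposition.** Let $p$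 and $q$ be positive integers with $q>p$ and let $(G,\mathcal S)$ be a set-equipped graph on $p$ vertices with $G$ essential and irreducible. 1. If $G$ is a directed cycle through all of its vertices, every $S_v$ is a singleton $\{s_v\}$, and $\sum_{v\in V(G)} s_v<q$, then no $\mathcal S$-graph shift on $q$ letters is conjugate to $X(G,\mathcal S)$. 2. In every other case, there is an $\mathcal S$-graph shift on $q$ letters that is conjugate to $X(G,\mathcal S)$. -/

import Mathlib

open SymbolicDynamics.FullShift

/-- A set-equipped graph on the vertex set `V`: a simple directed graph (no loops; multiple edges
are impossible, opposite edges `u → v`, `v → u` are allowed) together with a nonempty set `S v` of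
positive integers at each vertex `v`. -/
structure SetEquippedGraph (V : Type*) where
  graph : Digraph V
  loopless : ∀ v, ¬ graph.Adj v v
  S : V → Set ℕ
  nonempty : ∀ v, (S v).Nonempty
  pos : ∀ v, ∀ n ∈ S v, 0 < n

/-- There is a directed path from every vertex to every vertex. -/
def Digraph.IsIrreducible {V : Type*} (G : Digraph V) : Prop :=
  ∀ u v, Relation.ReflTransGen G.Adj u v

/-- Every vertex has in-degree and out-degree at least one. -/
def Digraph.IsEssential {V : Type*} (G : Digraph V) : Prop :=
  ∀ v, (∃ u, G.Adj u v) ∧ ∃ w, G.Adj v w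

/-- `G` is a directed cycle: the edges are exactly `v → c v` for a cyclic permutation `c` of all
the vertices. -/
def Digraph.IsDirectedCycle {V : Type*} (G : Digraph V) : Prop :=
  ∃ c : Equiv.Perm V, c.IsCycleOn Set.univ ∧ ∀ u v, G.Adj u v ↔ c u = v

namespace SetEquippedGraph

variable {V : Type*}

/-- The bi-infinite strings `⋯ u₋₁^{n₋₁} u₀^{n₀} u₁^{n₁} ⋯` with `n i ∈ S (u i)` and
`(u i, u (i + 1))` an edge for all `i`; the `i`-th block occupies the positions
`t i, …, t (i + 1) - 1`, and the origin may lie anywhere. -/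
def blockStrings (𝒢 : SetEquippedGraph V) : Set (ℤ → V) :=
  {x | ∃ (u : ℤ → V) (n : ℤ → ℕ) (t : ℤ → ℤ),
    (∀ i, n i ∈ 𝒢.S (u i)) ∧
    (∀ i, 𝒢.graph.Adj (u i) (u (i + 1))) ∧
    (∀ i, t (i + 1) = t i + n i) ∧
    ∀ i k, t i ≤ k → k < t (i + 1) → x k = u i}

theorem shift_mem_blockStrings (𝒢 : SetEquippedGraph V) (g : ℤ) {x : ℤ → V}
    (hx : x ∈ 𝒢.blockStrings) : shift g x ∈ 𝒢.blockStrings := by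
  obtain ⟨u, n, t, hn, hu, ht, h⟩ := hx
  refine ⟨u, n, fun i => t i - g, hn, hu, fun i => ?_, fun i k h1 h2 => ?_⟩
  · have := ht i
    dsimp only
    omega
  · rw [shift_apply]
    dsimp only at h1 h2
    exact h i _ (by omega) (by omega)

/-- The `𝒮`-graph shift `X(G, 𝒮)`, a subshift over the alphabet `V`. -/
def sgraphShift [TopologicalSpace V] (𝒢 : SetEquippedGraph V) : Subshift V ℤ where
  carrier := closure 𝒢.blockStrings
  isClosed := isClosed_closure
  mapsTo g := Set.MapsTo.closure (fun _ hx => 𝒢.shift_mem_blockStrings g hx)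
    (continuous_shift g)

end SetEquippedGraph

/-- The shift map `σ`, `(σ x) i = x (1 + i)`, on a subshift. -/
def subshiftMap {A : Type*} [TopologicalSpace A] (X : Subshift A ℤ) : X.carrier → X.carrier :=
  (X.mapsTo 1).restrict (shift 1) X.carrier X.carrier

/-- Two subshifts are conjugate if some homeomorphism between them commutes with the shift maps. -/
def SubshiftConjugate {A B : Type*} [TopologicalSpace A] [TopologicalSpace B]
    (X : Subshift A ℤ) (Y : Subshift B ℤ) : Prop :=
  ∃ φ : X.carrier ≃ₜ Y.carrier, ∀ x, φ (subshiftMap X x) = subshiftMap Y (φ x)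

/-! The first case is a count of points. On a directed cycle with singleton sets, a string is fixed
by the block covering the origin and the place of the origin in it, so there are at most `∑ v, s v`
strings (`blockStrings_finite_of_isDirectedCycle`). A shift on `q` letters has at least `q` points,
since each letter occurs at coordinate `0` of one (`exists_mem_blockStrings_apply_zero`).

In the other case letters are added one at a time. If some set contains `n ≠ 1`, the first letter of
every block at that vertex is renamed to a new letter (`splitHead`). Otherwise all blocks have
length one and a vertex with two out-edges is split (`splitOut`). Either recoding is a block map,
undone by renaming the new letter back.

The induction carries essentiality and `HasRoom`. It cannot get stuck: if all sets are `{1}` and no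
vertex branches, the sum of the sets' elements is the number of vertices, so `HasRoom` fails below
`q`. Irreducibility enters only at the start, in `hasRoom_of_not_directedCycle`. -/

/-! ### Bi-infinite sequences and integer predicates -/

/-- A relation that can be continued in both directions has a bi-infinite chain through any
given point. -/
theorem exists_int_chain {α : Type*} {R : α → α → Prop} (next : ∀ a, ∃ b, R a b)
    (prev : ∀ b, ∃ a, R a b) (a₀ : α) :
    ∃ f : ℤ → α, f 0 = a₀ ∧ ∀ i, R (f i) (f (i + 1)) := by
  choose s hs using next
  choose r hr using prev
  let f : ℤ → α := fun i => match i with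
    | Int.ofNat n => s^[n] a₀
    | Int.negSucc n => r^[n + 1] a₀
  refine ⟨f, rfl, fun i => ?_⟩
  match i with
  | Int.ofNat n =>
    change R (s^[n] a₀) (s^[n + 1] a₀)
    rw [Function.iterate_succ_apply']
    exact hs _
  | Int.negSucc 0 =>
    change R (r a₀) a₀
    exact hr _
  | Int.negSucc (n + 1) =>
    change R (r^[n + 2] a₀) (r^[n + 1] a₀)
    rw [Function.iterate_succ_apply']
    exact hr _

theorem Int.exists_next {D : ℤ → Prop} {k : ℤ} (h : ∃ b, k < b ∧ D b) :
    ∃ b, k < b ∧ D b ∧ ∀ c, k < c → c < b → ¬ D c := by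
  obtain ⟨b, ⟨hb, hD⟩, hmin⟩ := Int.exists_least_of_bdd (P := fun z => k < z ∧ D z)
    ⟨k, fun z hz => hz.1.le⟩ h
  exact ⟨b, hb, hD, fun c h1 h2 h3 => absurd (hmin c ⟨h1, h3⟩) (by omega)⟩

theorem Int.exists_prev {D : ℤ → Prop} {k : ℤ} (h : ∃ a, a < k ∧ D a) :
    ∃ a, a < k ∧ D a ∧ ∀ c, a < c → c < k → ¬ D c := by
  obtain ⟨b, ⟨hb, hD⟩, hmax⟩ := Int.exists_greatest_of_bdd (P := fun z => z < k ∧ D z)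
    ⟨k, fun z hz => hz.1.le⟩ h
  exact ⟨b, hb, hD, fun c h1 h2 h3 => absurd (hmax c ⟨h2, h3⟩) (by omega)⟩

/-- A sequence of integers with positive increments meets every integer with its blocks. -/
theorem Int.exists_block {t : ℤ → ℤ} (ht : ∀ i, t i < t (i + 1)) (k : ℤ) :
    ∃ i, t i ≤ k ∧ k < t (i + 1) := by
  have up : ∀ m : ℕ, ∀ i, t i + m ≤ t (i + m) := by
    intro m
    induction m with
    | zero => simp
    | succ m ih =>
      intro i
      have h1 := ih i
      have h2 := ht (i + m)
      rw [add_assoc] at h2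
      push_cast
      omega
  obtain ⟨i, hi, hmax⟩ := Int.exists_greatest_of_bdd (P := fun i => t i ≤ k) (by
    refine ⟨max 0 (k - t 0), fun z hz => ?_⟩
    by_contra! hc
    have := up z.toNat 0
    rw [Int.toNat_of_nonneg (by omega), zero_add] at this
    omega) (by
    refine ⟨-((t 0 - k).toNat : ℤ), ?_⟩
    have := up (t 0 - k).toNat (-((t 0 - k).toNat : ℤ))
    rw [neg_add_cancel] at this
    omega)
  refine ⟨i, hi, ?_⟩
  by_contra! hc
  have := hmax _ hc
  omega

/-! ### Runs of a bi-infinite string -/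

/-- A new run of equal letters of `x` starts at the position `k`. -/
def RunStart {V : Type*} (x : ℤ → V) (k : ℤ) : Prop := x (k - 1) ≠ x k

theorem eq_of_forall_not_runStart {V : Type*} {x : ℤ → V} {a b : ℤ}
    (h : ∀ c, a < c → c < b → ¬ RunStart x c) {k : ℤ} (hak : a ≤ k) (hkb : k < b) :
    x k = x a := by
  induction k, hak using Int.leInduction with
  | base => rfl
  | succ k hk ih =>
    have h1 := h (k + 1) (by omega) hkb
    rw [RunStart, not_not, add_sub_cancel_right] at h1
    rw [← h1, ih (by omega)]

namespace SetEquippedGraph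

/-- Consecutive blocks carry different letters, so the blocks of a string are its runs. -/
theorem mem_blockStrings_iff {V : Type*} (𝒢 : SetEquippedGraph V) (x : ℤ → V) :
    x ∈ 𝒢.blockStrings ↔
      (∀ k, ∃ a, a < k ∧ RunStart x a) ∧ (∀ k, ∃ b, k < b ∧ RunStart x b) ∧
      (∀ k, RunStart x k → 𝒢.graph.Adj (x (k - 1)) (x k)) ∧
      ∀ a b, a < b → RunStart x a → RunStart x b → (∀ c, a < c → c < b → ¬ RunStart x c) →
        (b - a).toNat ∈ 𝒢.S (x a) := by
  constructor
  · rintro ⟨u, n, t, hn, hu, ht, hx⟩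
    have hlt : ∀ i, t i < t (i + 1) := fun i => by
      have := 𝒢.pos _ _ (hn i)
      have := ht i
      omega
    have hlt' : ∀ i, t (i - 1) < t i := fun i => by simpa using hlt (i - 1)
    have hst : ∀ i, x (t i) = u i := fun i => hx i _ le_rfl (hlt i)
    have hpr : ∀ i, x (t i - 1) = u (i - 1) := fun i =>
      hx (i - 1) _ (by have := hlt' i; omega) (by rw [sub_add_cancel]; omega)
    have hadj : ∀ i, 𝒢.graph.Adj (u (i - 1)) (u i) := fun i => by simpa using hu (i - 1)
    have hrun : ∀ i, RunStart x (t i) := fun i h => by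
      rw [hst, hpr] at h
      have := hadj i
      rw [h] at this
      exact 𝒢.loopless _ this
    -- A position strictly inside a block has the same letter as its predecessor, so it starts no
    -- run.
    have hinv : ∀ k, RunStart x k → ∃ i, t i = k := fun k hk => by
      obtain ⟨i, h1, h2⟩ := Int.exists_block hlt k
      refine ⟨i, ?_⟩
      by_contra hne
      exact hk ((hx i (k - 1) (by omega) (by omega)).trans (hx i k h1 h2).symm)
    refine ⟨fun k => ?_, fun k => ?_, fun k hk => ?_, fun a b hab ha hb hc => ?_⟩
    · obtain ⟨i, h1, h2⟩ := Int.exists_block hlt k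
      exact ⟨t (i - 1), by have := hlt' i; omega, hrun _⟩
    · obtain ⟨i, h1, h2⟩ := Int.exists_block hlt k
      exact ⟨_, h2, hrun _⟩
    · obtain ⟨i, rfl⟩ := hinv k hk
      rw [hst, hpr]
      exact hadj i
    · obtain ⟨i, rfl⟩ := hinv a ha
      have hb' : b = t (i + 1) := by
        rcases lt_trichotomy b (t (i + 1)) with h | h | h
        · exact absurd ((hx i (b - 1) (by omega) (by omega)).trans (hx i b (by omega) h).symm) hb
        · exact h
        · exact absurd (hrun _) (hc _ (hlt i) h)
      rw [hb', hst, ht i, add_sub_cancel_left, Int.toNat_natCast]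
      exact hn i
  · rintro ⟨hl, hr, hadj, hS⟩
    obtain ⟨a₀, -, ha₀⟩ := hl 0
    -- The run starts, each linked to the next one, serve as the block boundaries.
    obtain ⟨t, -, ht⟩ := exists_int_chain (α := {k // RunStart x k})
      (R := fun a b => a.1 < b.1 ∧ ∀ c, a.1 < c → c < b.1 → ¬ RunStart x c)
      (fun a => by
        obtain ⟨b, h1, h2, h3⟩ := Int.exists_next (hr a.1)
        exact ⟨⟨b, h2⟩, h1, h3⟩)
      (fun b => by
        obtain ⟨a, h1, h2, h3⟩ := Int.exists_prev (hl b.1)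
        exact ⟨⟨a, h2⟩, h1, h3⟩) ⟨a₀, ha₀⟩
    refine ⟨fun i => x (t i), fun i => ((t (i + 1)).1 - (t i).1).toNat, fun i => (t i).1,
      fun i => hS _ _ (ht i).1 (t i).2 (t (i + 1)).2 (ht i).2, fun i => ?_, fun i => ?_,
      fun i k h1 h2 => eq_of_forall_not_runStart (ht i).2 h1 h2⟩
    · have h1 := hadj _ (t (i + 1)).2
      rwa [eq_of_forall_not_runStart (ht i).2 (by have := (ht i).1; omega) (by omega)] at h1
    · have := (ht i).1
      dsimp only
      omega

end SetEquippedGraph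

/-! ### Conjugacies -/

theorem SubshiftConjugate.trans {A B C : Type*} [TopologicalSpace A] [TopologicalSpace B]
    [TopologicalSpace C] {X : Subshift A ℤ} {Y : Subshift B ℤ} {Z : Subshift C ℤ}
    (h₁ : SubshiftConjugate X Y) (h₂ : SubshiftConjugate Y Z) : SubshiftConjugate X Z := by
  obtain ⟨φ, hφ⟩ := h₁
  obtain ⟨ψ, hψ⟩ := h₂
  exact ⟨φ.trans ψ, fun x => by simp [hφ, hψ]⟩

/-- The sliding block map with window `[-1, 1]` and local rule `f`. -/
def blockMap {A B : Type*} (f : A → A → A → B) (x : ℤ → A) : ℤ → B :=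
  fun k => f (x (k - 1)) (x k) (x (k + 1))

theorem continuous_blockMap {A B : Type*} [TopologicalSpace A] [DiscreteTopology A]
    [TopologicalSpace B] (f : A → A → A → B) : Continuous (blockMap f) := by
  refine continuous_pi fun k => ?_
  have h : Continuous fun p : A × A × A => f p.1 p.2.1 p.2.2 := continuous_of_discreteTopology
  exact h.comp (by fun_prop : Continuous fun x : ℤ → A => (x (k - 1), x k, x (k + 1)))

theorem blockMap_shift {A B : Type*} (f : A → A → A → B) (g : ℤ) (x : ℤ → A) :
    blockMap f (shift g x) = shift g (blockMap f x) := by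
  funext k
  simp only [blockMap, shift_apply, add_sub_assoc, add_assoc]

/-- Block maps that are inverse to each other on the block strings induce a conjugacy. -/
theorem SetEquippedGraph.conjugate_of_blockMap {V W : Type*} [TopologicalSpace V]
    [DiscreteTopology V] [TopologicalSpace W] [DiscreteTopology W]
    {𝒢 : SetEquippedGraph V} {ℋ : SetEquippedGraph W} (f : V → V → V → W) (g : W → W → W → V)
    (hf : Set.MapsTo (blockMap f) 𝒢.blockStrings ℋ.blockStrings)
    (hg : Set.MapsTo (blockMap g) ℋ.blockStrings 𝒢.blockStrings)
    (hgf : Set.LeftInvOn (blockMap g) (blockMap f) 𝒢.blockStrings)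
    (hfg : Set.LeftInvOn (blockMap f) (blockMap g) ℋ.blockStrings) :
    SubshiftConjugate 𝒢.sgraphShift ℋ.sgraphShift := by
  have cf := continuous_blockMap f
  have cg := continuous_blockMap g
  have Hf := hf.closure cf
  have Hg := hg.closure cg
  -- Two continuous maps into a Hausdorff space that agree on a set agree on its closure.
  have Hgf : Set.EqOn (blockMap g ∘ blockMap f) id (closure 𝒢.blockStrings) :=
    Set.EqOn.closure (fun x hx => hgf hx) (cg.comp cf) continuous_id
  have Hfg : Set.EqOn (blockMap f ∘ blockMap g) id (closure ℋ.blockStrings) :=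
    Set.EqOn.closure (fun x hx => hfg hx) (cf.comp cg) continuous_id
  refine ⟨⟨⟨Hf.restrict, Hg.restrict, fun x => Subtype.ext (Hgf x.2),
    fun x => Subtype.ext (Hfg x.2)⟩, cf.restrict Hf, cg.restrict Hg⟩, fun x => ?_⟩
  exact Subtype.ext (blockMap_shift f 1 x.1)

/-! ### Graphs with room for `q` letters -/

namespace SetEquippedGraph

variable {V : Type*}

/-- A vertex has two out-edges, or a set has two elements, or all sets are singletons with
sum at least `q`. -/
def HasRoom [Fintype V] (𝒢 : SetEquippedGraph V) (q : ℕ) : Prop :=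
  (∃ v a b, a ≠ b ∧ 𝒢.graph.Adj v a ∧ 𝒢.graph.Adj v b) ∨
  (∃ v, ∃ m ∈ 𝒢.S v, ∃ n ∈ 𝒢.S v, m ≠ n) ∨
  ∃ s : V → ℕ, (∀ v, 𝒢.S v = {s v}) ∧ q ≤ ∑ v, s v

theorem ne_of_adj (𝒢 : SetEquippedGraph V) {u v : V} (h : 𝒢.graph.Adj u v) : u ≠ v := by
  rintro rfl
  exact 𝒢.loopless _ h

/-! ### Splitting off the first letter of each block at a vertex -/

/-- The adjacency relation of `splitHead`. -/
def SplitHeadAdj (𝒢 : SetEquippedGraph V) (v : V) : Option V → Option V → Prop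
  | none, none => False
  -- A block `v ^ 1` leaves only `none` behind, which must then continue along the out-edges of `v`.
  | none, some w => w = v ∨ (1 ∈ 𝒢.S v ∧ 𝒢.graph.Adj v w)
  | some u, none => 𝒢.graph.Adj u v
  | some u, some w => w ≠ v ∧ 𝒢.graph.Adj u w

/-- The sets of `splitHead`. -/
def splitHeadS (𝒢 : SetEquippedGraph V) (v : V) : Option V → Set ℕ
  | none => {1}
  | some w => {n | 0 < n ∧ (w = v → n + 1 ∈ 𝒢.S v) ∧ (w ≠ v → n ∈ 𝒢.S w)}

/-- Each block `v ^ n` is replaced by `none v ^ (n - 1)`, where `none` is a new vertex. -/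
def splitHead (𝒢 : SetEquippedGraph V) (v : V) (hv : ∃ n ∈ 𝒢.S v, n ≠ 1) :
    SetEquippedGraph (Option V) where
  graph := ⟨𝒢.SplitHeadAdj v⟩
  loopless
    | none => id
    | some w => fun h => 𝒢.loopless w h.2
  S := 𝒢.splitHeadS v
  nonempty
    | none => ⟨1, rfl⟩
    | some w => by
      by_cases hw : w = v
      · obtain ⟨n, hn, h1⟩ := hv
        have := 𝒢.pos _ _ hn
        exact ⟨n - 1, by omega, fun _ => by rwa [Nat.sub_add_cancel this], fun h => absurd hw h⟩
      · obtain ⟨n, hn⟩ := 𝒢.nonempty w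
        exact ⟨n, 𝒢.pos _ _ hn, fun h => absurd h hw, fun _ => hn⟩
  pos
    | none => fun n hn => by
      rw [show n = 1 from hn]
      exact one_pos
    | some w => fun n hn => hn.1

section splitHead

variable (𝒢 : SetEquippedGraph V) (v : V) (hv : ∃ n ∈ 𝒢.S v, n ≠ 1)

theorem splitHead_isEssential (h : 𝒢.graph.IsEssential) :
    (𝒢.splitHead v hv).graph.IsEssential := by
  rintro (_ | w)
  · obtain ⟨u, hu⟩ := (h v).1
    exact ⟨⟨some u, hu⟩, some v, Or.inl rfl⟩
  · constructor
    · by_cases hw : w = v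
      · exact ⟨none, Or.inl hw⟩
      · obtain ⟨u, hu⟩ := (h w).1
        exact ⟨some u, hw, hu⟩
    · obtain ⟨u, hu⟩ := (h w).2
      by_cases huv : u = v
      · exact ⟨none, show 𝒢.graph.Adj w v from huv ▸ hu⟩
      · exact ⟨some u, huv, hu⟩

/-- Branching survives with `none` in the role of the target `v`. Two elements of `S v` are both
lowered by one, unless `1 ∈ S v`, and then `none` branches to `v` and to a successor of `v`. For
singletons, `s v = 1 + (s v - 1)` preserves the sum. -/
theorem splitHead_hasRoom [Fintype V] (h : 𝒢.graph.IsEssential) {q : ℕ} (hq : 𝒢.HasRoom q) :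
    (𝒢.splitHead v hv).HasRoom q := by
  classical
  rcases hq with ⟨u, a, b, hab, ha, hb⟩ | ⟨u, m, hm, n, hn, hmn⟩ | ⟨s, hs, hsum⟩
  · left
    by_cases hav : a = v
    · subst hav
      exact ⟨some u, none, some b, by simp, ha, hab.symm, hb⟩
    · by_cases hbv : b = v
      · subst hbv
        exact ⟨some u, some a, none, by simp, ⟨hab, ha⟩, hb⟩
      · exact ⟨some u, some a, some b, by simpa using hab, ⟨hav, ha⟩, hbv, hb⟩
  · by_cases huv : u = v
    · subst huv
      by_cases h1 : 1 ∈ 𝒢.S u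
      · left
        obtain ⟨w, hw⟩ := (h u).2
        exact ⟨none, some u, some w, by simpa using 𝒢.ne_of_adj hw, Or.inl rfl, Or.inr ⟨h1, hw⟩⟩
      · have key : ∀ k ∈ 𝒢.S u, 1 < k := fun k hk => by
          have := 𝒢.pos _ _ hk
          have : k ≠ 1 := by
            rintro rfl
            exact h1 hk
          omega
        have hm1 := key m hm
        have hn1 := key n hn
        right; left
        refine ⟨some u, m - 1, ⟨by omega, fun _ => ?_, fun h => absurd rfl h⟩, n - 1,
          ⟨by omega, fun _ => ?_, fun h => absurd rfl h⟩, by omega⟩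
        · rwa [Nat.sub_add_cancel hm1.le]
        · rwa [Nat.sub_add_cancel hn1.le]
    · right; left
      exact ⟨some u, m, ⟨𝒢.pos _ _ hm, fun h => absurd h huv, fun _ => hm⟩, n,
        ⟨𝒢.pos _ _ hn, fun h => absurd h huv, fun _ => hn⟩, hmn⟩
  · right; right
    have hsv : 1 < s v := by
      obtain ⟨n, hn, h1⟩ := hv
      have := 𝒢.pos _ _ hn
      rw [hs] at hn
      rw [← show n = s v from hn]
      omega
    have hpos : ∀ w, 0 < s w := fun w => 𝒢.pos w _ (by rw [hs]; rfl)
    refine ⟨fun o => o.elim 1 fun w => if w = v then s v - 1 else s w, ?_, ?_⟩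
    · rintro (_ | w)
      · rfl
      · ext n
        change (0 < n ∧ (w = v → n + 1 ∈ 𝒢.S v) ∧ (w ≠ v → n ∈ 𝒢.S w)) ↔
          n = if w = v then s v - 1 else s w
        have := hpos w
        by_cases hw : w = v
        · simp only [hw, hs, ne_eq, Set.mem_singleton_iff, if_true, not_true, forall_const]
          constructor
          · rintro ⟨h1, h2, -⟩
            omega
          · intro h
            exact ⟨by omega, by omega, fun h => absurd h not_false⟩
        · simp only [hw, hs, ne_eq, Set.mem_singleton_iff, if_false, not_false_eq_true]
          constructor
          · rintro ⟨h1, -, h2⟩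
            exact h2 trivial
          · intro h
            exact ⟨by omega, fun h => h.elim, fun _ => h⟩
    · rw [Fintype.sum_option]
      have e : ∑ w, s w = s v + ∑ w ∈ Finset.univ.erase v, s w :=
        (Finset.add_sum_erase _ _ (Finset.mem_univ v)).symm
      have e' := (Finset.add_sum_erase Finset.univ
        (fun w => if w = v then s v - 1 else s w) (Finset.mem_univ v)).symm
      have e'' : ∑ w ∈ Finset.univ.erase v, (if w = v then s v - 1 else s w) =
          ∑ w ∈ Finset.univ.erase v, s w :=
        Finset.sum_congr rfl fun w hw => if_neg (Finset.ne_of_mem_erase hw)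
      rw [e''] at e'
      simp only [if_true] at e'
      simp only [Option.elim]
      omega

end splitHead

/-! ### Out-splitting a vertex of a vertex shift -/

/-- The adjacency relation of `splitOut`. -/
def SplitOutAdj (𝒢 : SetEquippedGraph V) (v a : V) : Option V → Option V → Prop
  | none, none => False
  | none, some w => w = a
  | some u, none => 𝒢.graph.Adj u v
  | some u, some w => 𝒢.graph.Adj u w ∧ ¬ (u = v ∧ w = a)

/-- The edge from `v` to `a` is moved to a new copy `none` of `v`. -/
def splitOut (𝒢 : SetEquippedGraph V) (v a : V) : SetEquippedGraph (Option V) where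
  graph := ⟨𝒢.SplitOutAdj v a⟩
  loopless
    | none => id
    | some w => fun h => 𝒢.loopless w h.1
  S o := o.elim {1} 𝒢.S
  nonempty
    | none => ⟨1, rfl⟩
    | some w => 𝒢.nonempty w
  pos
    | none => fun n hn => by
      rw [show n = 1 from hn]
      exact one_pos
    | some w => 𝒢.pos w

/-- All blocks have length one, so the strings are the bi-infinite walks, as in a vertex shift. -/
theorem mem_blockStrings_of_S_eq_one (𝒢 : SetEquippedGraph V) (hS : ∀ v, 𝒢.S v = {1})
    (x : ℤ → V) : x ∈ 𝒢.blockStrings ↔ ∀ k, 𝒢.graph.Adj (x k) (x (k + 1)) := by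
  constructor
  · rintro ⟨u, n, t, hn, hu, ht, hx⟩ k
    have ht' : ∀ i, t (i + 1) = t i + 1 := fun i => by
      have := hn i
      rw [hS] at this
      rw [ht, show n i = 1 from this, Nat.cast_one]
    obtain ⟨i, h1, h2⟩ := Int.exists_block (fun i => by have := ht' i; omega : ∀ i, t i < t (i + 1)) k
    have h3 := ht' i
    have h4 := ht' (i + 1)
    rw [hx i k h1 h2, hx (i + 1) (k + 1) (by omega) (by omega)]
    exact hu i
  · intro h
    refine ⟨x, fun _ => 1, id, fun i => by rw [hS]; rfl, h, fun i => rfl, fun i k h1 h2 => ?_⟩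
    rw [show k = i by simp only [id] at h1 h2; omega]

section splitOut

variable (𝒢 : SetEquippedGraph V) {v a b : V}

/-- The second edge `v → b` is what `v` keeps after its edge to `a` has moved. -/
theorem splitOut_isEssential (h : 𝒢.graph.IsEssential) (hab : a ≠ b)
    (hb : 𝒢.graph.Adj v b) : (𝒢.splitOut v a).graph.IsEssential := by
  rintro (_ | w)
  · obtain ⟨u, hu⟩ := (h v).1
    exact ⟨⟨some u, hu⟩, some a, rfl⟩
  · constructor
    · by_cases hw : w = a
      · exact ⟨none, hw⟩
      · obtain ⟨u, hu⟩ := (h w).1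
        exact ⟨some u, hu, fun h => hw h.2⟩
    · by_cases hw : w = v
      · exact ⟨some b, hw ▸ hb, fun h => hab h.2.symm⟩
      · obtain ⟨u, hu⟩ := (h w).2
        exact ⟨some u, hu, fun h => hw h.1⟩

/-- Any predecessor of `v` now branches to both copies, so further splitting is never blocked. -/
theorem splitOut_hasRoom [Fintype V] (h : 𝒢.graph.IsEssential) (ha : 𝒢.graph.Adj v a) (q : ℕ) :
    (𝒢.splitOut v a).HasRoom q := by
  obtain ⟨u, hu⟩ := (h v).1
  exact Or.inl ⟨some u, none, some v, by simp, hu, hu, fun h => 𝒢.ne_of_adj ha h.2⟩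

/-- The next letter tells the copies apart: `none` is exactly a `v` followed by `a`. The inverse
forgets the distinction. -/
theorem splitOut_conjugate [TopologicalSpace V] [DiscreteTopology V] [TopologicalSpace (Option V)]
    [DiscreteTopology (Option V)] (hS : ∀ v, 𝒢.S v = {1}) (ha : 𝒢.graph.Adj v a) :
    SubshiftConjugate 𝒢.sgraphShift (𝒢.splitOut v a).sgraphShift := by
  classical
  have hva : v ≠ a := 𝒢.ne_of_adj ha
  have hS' : ∀ o, (𝒢.splitOut v a).S o = {1}
    | none => rfl
    | some w => hS w
  refine conjugate_of_blockMap (fun _ y z => if y = v ∧ z = a then none else some y)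
    (fun _ y _ => y.getD v) (fun x hx => ?_) (fun y hy => ?_) (fun x hx => ?_) fun y hy => ?_
  · rw [mem_blockStrings_of_S_eq_one _ hS] at hx
    rw [mem_blockStrings_of_S_eq_one _ hS']
    intro k
    have h1 := hx k
    simp only [blockMap]
    split_ifs with h2 h3 h3
    · exact absurd (h3.1.symm.trans h2.2) hva
    · exact h2.2
    · exact show 𝒢.graph.Adj _ v from h3.1 ▸ h1
    · exact ⟨h1, h2⟩
  · rw [mem_blockStrings_of_S_eq_one _ hS'] at hy
    rw [mem_blockStrings_of_S_eq_one _ hS]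
    intro k
    have h1 := hy k
    simp only [blockMap]
    revert h1
    generalize y k = c
    generalize y (k + 1) = d
    rcases c with _ | c <;> rcases d with _ | d <;> intro h1
    · exact h1.elim
    · rw [show d = a from h1]
      exact ha
    · exact h1
    · exact h1.1
  · funext k
    simp only [blockMap]
    split_ifs with h
    · exact h.1.symm
    · rfl
  · rw [mem_blockStrings_of_S_eq_one _ hS'] at hy
    funext k
    have key : ∀ c d, 𝒢.SplitOutAdj v a c d →
        (if c.getD v = v ∧ d.getD v = a then none else some (c.getD v)) = c := by
      rintro (_ | c) (_ | d) h1
      · exact h1.elim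
      · exact if_pos ⟨rfl, h1⟩
      · exact if_neg fun h => hva h.2
      · exact if_neg h1.2
    exact key _ _ (hy k)

end splitOut

/-! ### Relabelling the vertices -/

/-- The set-equipped graph on `W` obtained along a bijection with the vertices. -/
def relabel {W : Type*} (𝒢 : SetEquippedGraph V) (e : W ≃ V) : SetEquippedGraph W where
  graph := ⟨fun u w => 𝒢.graph.Adj (e u) (e w)⟩
  loopless u := 𝒢.loopless (e u)
  S u := 𝒢.S (e u)
  nonempty u := 𝒢.nonempty (e u)
  pos u := 𝒢.pos (e u)

theorem relabel_isEssential {W : Type*} (𝒢 : SetEquippedGraph V) (e : W ≃ V)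
    (h : 𝒢.graph.IsEssential) : (𝒢.relabel e).graph.IsEssential := fun w => by
  obtain ⟨⟨a, ha⟩, b, hb⟩ := h (e w)
  refine ⟨⟨e.symm a, ?_⟩, e.symm b, ?_⟩
  · change 𝒢.graph.Adj (e (e.symm a)) (e w)
    rwa [e.apply_symm_apply]
  · change 𝒢.graph.Adj (e w) (e (e.symm b))
    rwa [e.apply_symm_apply]

theorem relabel_conjugate {W : Type*} [TopologicalSpace V] [DiscreteTopology V]
    [TopologicalSpace W] [DiscreteTopology W] (𝒢 : SetEquippedGraph V) (e : W ≃ V) :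
    SubshiftConjugate 𝒢.sgraphShift (𝒢.relabel e).sgraphShift := by
  refine conjugate_of_blockMap (fun _ y _ => e.symm y) (fun _ y _ => e y) ?_ ?_
    (fun x _ => funext fun k => e.apply_symm_apply _)
    (fun x _ => funext fun k => e.symm_apply_apply _)
  · rintro x ⟨u, n, t, hn, hu, ht, hx⟩
    refine ⟨fun i => e.symm (u i), n, t, fun i => ?_, fun i => ?_, ht,
      fun i k h1 h2 => congrArg e.symm (hx i k h1 h2)⟩
    · change n i ∈ 𝒢.S (e (e.symm (u i)))
      rw [e.apply_symm_apply]
      exact hn i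
    · change 𝒢.graph.Adj (e (e.symm (u i))) (e (e.symm (u (i + 1))))
      rw [e.apply_symm_apply, e.apply_symm_apply]
      exact hu i
  · rintro x ⟨u, n, t, hn, hu, ht, hx⟩
    exact ⟨fun i => e (u i), n, t, hn, hu, ht, fun i k h1 h2 => congrArg e (hx i k h1 h2)⟩

end SetEquippedGraph

/-! ### Splitting off heads is a conjugacy -/

namespace SetEquippedGraph

variable {V : Type*}

theorem exists_run {𝒢 : SetEquippedGraph V} {x : ℤ → V} (hx : x ∈ 𝒢.blockStrings) (k : ℤ) :
    ∃ a b, a ≤ k ∧ k < b ∧ RunStart x b ∧ x k = x a ∧ (b - a).toNat ∈ 𝒢.S (x a) := by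
  obtain ⟨hl, hr, -, hS⟩ := (𝒢.mem_blockStrings_iff x).1 hx
  obtain ⟨a, h1, ha, h2⟩ := Int.exists_prev (hl (k + 1))
  obtain ⟨b, h3, hb, h4⟩ := Int.exists_next (hr k)
  have hc : ∀ c, a < c → c < b → ¬ RunStart x c := fun c h5 h6 => by
    by_cases h : c < k + 1
    · exact h2 c h5 h
    · exact h4 c (by omega) h6
  exact ⟨a, b, by omega, h3, hb, eq_of_forall_not_runStart hc (by omega) h3,
    hS a b (by omega) ha hb hc⟩

section splitHead

variable (𝒢 : SetEquippedGraph V) (v : V) (hv : ∃ n ∈ 𝒢.S v, n ≠ 1)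

/-- `y` is obtained from `x` by changing the first letter of each run of `v` into `none`. -/
def IsHeadMarking (v : V) (x : ℤ → V) (y : ℤ → Option V) : Prop :=
  ∀ k, (x k = v ∧ x (k - 1) ≠ v → y k = none) ∧ (¬ (x k = v ∧ x (k - 1) ≠ v) → y k = some (x k))

variable {𝒢 v} {x : ℤ → V} {y : ℤ → Option V}

/-- Marking only adds boundaries, namely one directly after each marked letter. -/
theorem IsHeadMarking.runStart_iff (h : IsHeadMarking v x y) (k : ℤ) :
    RunStart y k ↔ RunStart x k ∨ (x (k - 1) = v ∧ RunStart x (k - 1)) := by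
  have h1 := h k
  have h2 := h (k - 1)
  unfold RunStart
  by_cases c1 : x k = v ∧ x (k - 1) ≠ v <;> by_cases c2 : x (k - 1) = v ∧ x (k - 1 - 1) ≠ v
  · exact absurd c2.1 c1.2
  · rw [h1.1 c1, h2.2 c2]
    have : x (k - 1) ≠ x k := by rw [c1.1]; exact c1.2
    simp [this]
  · rw [h1.2 c1, h2.1 c2]
    have : x (k - 1 - 1) ≠ x (k - 1) := by rw [c2.1]; exact c2.2
    exact ⟨fun _ => Or.inr ⟨c2.1, this⟩, fun _ => by simp⟩
  · rw [h1.2 c1, h2.2 c2]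
    have : ¬ (x (k - 1) = v ∧ x (k - 1 - 1) ≠ x (k - 1)) := by
      rintro ⟨h3, h4⟩
      exact c2 ⟨h3, h3 ▸ h4⟩
    simp [this]

theorem IsHeadMarking.mem_splitHead (h : IsHeadMarking v x y) (hx : x ∈ 𝒢.blockStrings) :
    y ∈ (𝒢.splitHead v hv).blockStrings := by
  obtain ⟨hl, hr, hadj, hS⟩ := (𝒢.mem_blockStrings_iff x).1 hx
  have hxy : ∀ {k}, RunStart x k → RunStart y k := fun hk => (h.runStart_iff _).2 (Or.inl hk)
  have hnext : ∀ {k}, x k = v → RunStart x k → RunStart y (k + 1) := fun {k} h1 h2 =>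
    (h.runStart_iff _).2 (Or.inr (by simpa using ⟨h1, h2⟩))
  rw [mem_blockStrings_iff]
  refine ⟨fun k => ?_, fun k => ?_, fun k hk => ?_, fun a b hab ha hb hc => ?_⟩
  · obtain ⟨a, h1, h2⟩ := hl k
    exact ⟨a, h1, hxy h2⟩
  · obtain ⟨a, h1, h2⟩ := hr k
    exact ⟨a, h1, hxy h2⟩
  · change 𝒢.SplitHeadAdj v _ _
    by_cases hk' : RunStart x k
    · have h1 := hadj k hk'
      by_cases c : x k = v
      · have c' : x (k - 1) ≠ v := c ▸ hk'
        rw [(h k).1 ⟨c, c'⟩, (h (k - 1)).2 fun h => c' h.1]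
        exact c ▸ h1
      · rw [(h k).2 fun h => c h.1]
        by_cases c' : x (k - 1) = v ∧ x (k - 1 - 1) ≠ v
        · rw [(h (k - 1)).1 c']
          have h2 : RunStart x (k - 1) := by
            rw [RunStart, c'.1]
            exact c'.2
          -- The run of `v` at `k - 1` ends at once, which puts `1` into `S v`.
          have h3 := hS (k - 1) k (by omega) h2 hk' (fun c _ _ => by omega)
          rw [c'.1, sub_sub_cancel, Int.toNat_one] at h3
          exact Or.inr ⟨h3, c'.1 ▸ h1⟩
        · rw [(h (k - 1)).2 c']
          exact ⟨c, h1⟩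
    · obtain ⟨h1, h2⟩ := ((h.runStart_iff k).1 hk).resolve_left hk'
      have h3 : x k = v := by
        rw [RunStart, not_not] at hk'
        rw [← hk', h1]
      rw [(h (k - 1)).1 ⟨h1, h1 ▸ h2⟩, (h k).2 fun h => h.2 h1]
      exact Or.inl h3
  · have hcx : ∀ c, a < c → c < b → ¬ RunStart x c := fun c h1 h2 h3 => hc c h1 h2 (hxy h3)
    change _ ∈ 𝒢.splitHeadS v _
    by_cases c : x a = v ∧ x (a - 1) ≠ v
    · have h1 : RunStart x a := by
        rw [RunStart, c.1]
        exact c.2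
      have h2 : b = a + 1 := by
        by_contra hne
        exact hc (a + 1) (by omega) (by omega) (hnext c.1 h1)
      rw [(h a).1 c, h2, add_sub_cancel_left]
      rfl
    · rw [(h a).2 c]
      -- Otherwise `b - 1` would be a marked head: at `a` this is excluded by assumption, further
      -- right it would be a boundary inside the run.
      have hbx : ¬ (x a = v ∧ RunStart x a) → RunStart x b := fun h0 => by
        refine ((h.runStart_iff b).1 hb).resolve_right ?_
        rintro ⟨h1, h2⟩
        rcases (show a ≤ b - 1 by omega).eq_or_lt with h3 | h3
        · exact h0 (h3 ▸ ⟨h1, h2⟩)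
        · exact hcx _ h3 (by omega) h2
      by_cases hav : x a = v
      -- This run of `y` is the tail of a run of `v` in `x` whose head sits at `a - 1`.
      · have h1 : x (a - 1) = v := not_not.1 fun h => c ⟨hav, h⟩
        have h2 : ¬ RunStart x a := fun h => h (h1.trans hav.symm)
        have h3 := ((h.runStart_iff a).1 ha).resolve_left h2
        have h4 := hS (a - 1) b (by omega) h3.2 (hbx fun h => h2 h.2) fun c h5 h6 => by
          rcases (show a ≤ c by omega).eq_or_lt with h7 | h7
          · exact h7 ▸ h2
          · exact hcx c h7 h6
        refine ⟨by omega, fun _ => ?_, fun h => absurd hav h⟩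
        rw [h1] at h4
        rwa [show (b - a).toNat + 1 = (b - (a - 1)).toNat by omega]
      · have h1 : RunStart x a := by
          by_contra h0
          have h2 := ((h.runStart_iff a).1 ha).resolve_left h0
          rw [RunStart, not_not] at h0
          exact hav (h0.symm.trans h2.1)
        exact ⟨by omega, fun h => absurd h hav,
          fun _ => hS a b hab h1 (hbx fun h => hav h.1) hcx⟩

theorem IsHeadMarking.mem_of_mem_splitHead (h : IsHeadMarking v x y)
    (hy : y ∈ (𝒢.splitHead v hv).blockStrings) : x ∈ 𝒢.blockStrings := by
  obtain ⟨hl, hr, hadj, hS⟩ := ((𝒢.splitHead v hv).mem_blockStrings_iff y).1 hy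
  replace hadj : ∀ k, RunStart y k → 𝒢.SplitHeadAdj v (y (k - 1)) (y k) := hadj
  replace hS : ∀ a b, a < b → RunStart y a → RunStart y b → (∀ c, a < c → c < b → ¬ RunStart y c) →
    (b - a).toNat ∈ 𝒢.splitHeadS v (y a) := hS
  have hxy : ∀ {k}, RunStart x k → RunStart y k := fun hk => (h.runStart_iff _).2 (Or.inl hk)
  rw [mem_blockStrings_iff]
  refine ⟨fun k => ?_, fun k => ?_, fun k hk => ?_, fun a b hab ha hb hc => ?_⟩
  · obtain ⟨a, h1, h2⟩ := hl k
    rcases (h.runStart_iff a).1 h2 with h3 | h3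
    · exact ⟨a, h1, h3⟩
    · exact ⟨a - 1, by omega, h3.2⟩
  -- A start in `y` can lie one position after the start in `x` that causes it, hence the search
  -- beyond `k + 1`.
  · obtain ⟨a, h1, h2⟩ := hr (k + 1)
    rcases (h.runStart_iff a).1 h2 with h3 | h3
    · exact ⟨a, by omega, h3⟩
    · exact ⟨a - 1, by omega, h3.2⟩
  · have h1 := hadj k (hxy hk)
    by_cases c : x k = v
    · have c' : x (k - 1) ≠ v := c ▸ hk
      rw [(h k).1 ⟨c, c'⟩, (h (k - 1)).2 fun h => c' h.1] at h1
      exact c.symm ▸ h1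
    · rw [(h k).2 fun h => c h.1] at h1
      by_cases c' : x (k - 1) = v ∧ x (k - 1 - 1) ≠ v
      · rw [(h (k - 1)).1 c'] at h1
        rw [c'.1]
        exact (h1.resolve_left c).2
      · rw [(h (k - 1)).2 c'] at h1
        exact h1.2
  · by_cases hav : x a = v
    · have h1 : x (a - 1) ≠ v := hav ▸ ha
      have h2 : RunStart y (a + 1) := (h.runStart_iff _).2 (Or.inr (by simpa using ⟨hav, ha⟩))
      rw [hav]
      -- A run of length one is allowed by the edge leaving `none`; a longer run has a tail whose
      -- length is one less.
      by_cases hb1 : b = a + 1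
      · subst hb1
        have h3 := hadj _ h2
        have h4 : x (a + 1) ≠ v := fun h0 => hb (by rw [add_sub_cancel_right, hav, h0])
        rw [add_sub_cancel_right, (h a).1 ⟨hav, h1⟩, (h (a + 1)).2 fun h => h4 h.1] at h3
        rw [add_sub_cancel_left]
        exact (h3.resolve_left h4).1
      · have h3 : x (a + 1) = v := by
          rw [← hav]
          exact eq_of_forall_not_runStart hc (by omega) (by omega)
        have h4 := hS (a + 1) b (by omega) h2 (hxy hb) fun c h5 h6 h7 => by
          rcases (h.runStart_iff c).1 h7 with h8 | h8
          · exact hc c (by omega) h6 h8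
          · exact hc (c - 1) (by omega) (by omega) h8.2
        rw [(h (a + 1)).2 fun h => h.2 (by rwa [add_sub_cancel_right])] at h4
        rw [show (b - a).toNat = (b - (a + 1)).toNat + 1 by omega]
        exact h4.2.1 h3
    · have h4 := hS a b hab (hxy ha) (hxy hb) fun c h5 h6 h7 => by
        rcases (h.runStart_iff c).1 h7 with h8 | h8
        · exact hc c (by omega) h6 h8
        · rcases (show a ≤ c - 1 by omega).eq_or_lt with h9 | h9
          · exact hav (h9 ▸ h8.1)
          · exact hc (c - 1) h9 (by omega) h8.2
      rw [(h a).2 fun h => hav h.1] at h4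
      exact h4.2.2 hav

/-- Blocks of `none` have length one and are entered only from predecessors of `v`, which differ
from `v`. A run of the old letter `v` can be entered only from `none`. So `none` marks precisely the
heads. -/
theorem isHeadMarking_getD (hy : y ∈ (𝒢.splitHead v hv).blockStrings) :
    IsHeadMarking v (fun k => (y k).getD v) y := by
  have hnone : ∀ k, y k = none → y (k + 1) ≠ none := fun k hk => by
    obtain ⟨a, b, h1, h2, h3, h4, h5⟩ := exists_run hy k
    rw [← h4, hk] at h5
    have h6 : (b - a).toNat = 1 := h5
    rw [RunStart, show b - 1 = k by omega, show b = k + 1 by omega, hk] at h3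
    exact h3.symm
  have hadj : ∀ k, RunStart y k → 𝒢.SplitHeadAdj v (y (k - 1)) (y k) :=
    (((𝒢.splitHead v hv).mem_blockStrings_iff y).1 hy).2.2.1
  intro k
  have h1 := hadj k
  have h2 := hnone (k - 1)
  rw [sub_add_cancel] at h2
  unfold RunStart at h1
  dsimp only
  rcases hk : y k with _ | w <;> rcases hk' : y (k - 1) with _ | u <;> rw [hk, hk'] at h1
  · exact absurd hk (h2 hk')
  · have h3 : 𝒢.graph.Adj u v := h1 (by simp)
    exact ⟨fun _ => rfl, fun h => absurd ⟨rfl, 𝒢.ne_of_adj h3⟩ h⟩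
  · exact ⟨fun h => absurd rfl h.2, fun _ => rfl⟩
  · refine ⟨fun h => ?_, fun _ => rfl⟩
    simp only [Option.getD_some] at h
    have h3 : w ≠ v ∧ 𝒢.graph.Adj u w := h1 fun h0 => by
      rw [Option.some_inj] at h0
      exact h.2 (h0.trans h.1)
    exact absurd h.1 h3.1

theorem splitHead_conjugate [TopologicalSpace V] [DiscreteTopology V]
    [TopologicalSpace (Option V)] [DiscreteTopology (Option V)] :
    SubshiftConjugate 𝒢.sgraphShift (𝒢.splitHead v hv).sgraphShift := by
  classical
  have hmark : ∀ x, IsHeadMarking v x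
      (blockMap (fun w y _ => if y = v ∧ w ≠ v then none else some y) x) := fun x k =>
    ⟨fun h => if_pos h, fun h => if_neg h⟩
  refine conjugate_of_blockMap (fun w y _ => if y = v ∧ w ≠ v then none else some y)
    (fun _ y _ => y.getD v) (fun x hx => (hmark x).mem_splitHead hv hx)
    (fun y hy => (isHeadMarking_getD hv hy).mem_of_mem_splitHead hv hy) (fun x hx => ?_)
    fun y hy => ?_
  · funext k
    simp only [blockMap]
    split_ifs with h
    · exact h.1.symm
    · rfl
  · funext k
    have h := isHeadMarking_getD hv hy k
    by_cases h1 : (y k).getD v = v ∧ (y (k - 1)).getD v ≠ v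
    · exact (if_pos h1).trans (h.1 h1).symm
    · exact (if_neg h1).trans (h.2 h1).symm

end splitHead

end SetEquippedGraph

namespace SetEquippedGraph

variable {V : Type*}

/-! ### Adding vertices -/

theorem exists_conjugate_option [Fintype V] [TopologicalSpace V] [DiscreteTopology V]
    [TopologicalSpace (Option V)] [DiscreteTopology (Option V)] (𝒢 : SetEquippedGraph V)
    (hess : 𝒢.graph.IsEssential) {q : ℕ} (hq : 𝒢.HasRoom q) (hV : Fintype.card V < q) :
    ∃ ℋ : SetEquippedGraph (Option V), ℋ.graph.IsEssential ∧ ℋ.HasRoom q ∧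
      SubshiftConjugate 𝒢.sgraphShift ℋ.sgraphShift := by
  by_cases h : ∃ v, ∃ n ∈ 𝒢.S v, n ≠ 1
  · obtain ⟨v, hv⟩ := h
    exact ⟨𝒢.splitHead v hv, 𝒢.splitHead_isEssential v hv hess,
      𝒢.splitHead_hasRoom v hv hess hq, splitHead_conjugate hv⟩
  · push Not at h
    have hS : ∀ v, 𝒢.S v = {1} := fun v =>
      (𝒢.nonempty v).subset_singleton_iff.1 fun n hn => h v n hn
    rcases hq with ⟨v, a, b, hab, ha, hb⟩ | ⟨u, m, hm, n, hn, hmn⟩ | ⟨s, hs, hsum⟩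
    · exact ⟨𝒢.splitOut v a, 𝒢.splitOut_isEssential hess hab hb, 𝒢.splitOut_hasRoom hess ha q,
        𝒢.splitOut_conjugate hS ha⟩
    · exact absurd ((h u m hm).trans (h u n hn).symm) hmn
    -- The sum would equal the number of vertices, which is less than `q`.
    · have h1 : ∀ v, s v = 1 := fun v => h v _ (by rw [hs]; rfl)
      simp only [h1, Finset.sum_const, Finset.card_univ, smul_eq_mul, mul_one] at hsum
      omega

/-- Induction on the number `d` of missing letters; the vertex type is quantified inside because
each step passes to `Option V`. -/
theorem exists_conjugate_fin {q : ℕ} (d : ℕ) : ∀ {V : Type*} [Fintype V] [TopologicalSpace V]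
    [DiscreteTopology V] (𝒢 : SetEquippedGraph V), Fintype.card V + d = q →
    𝒢.graph.IsEssential → 𝒢.HasRoom q → ∃ ℋ : SetEquippedGraph (Fin q), ℋ.graph.IsEssential ∧
      SubshiftConjugate 𝒢.sgraphShift ℋ.sgraphShift := by
  induction d with
  | zero =>
    intro V _ _ _ 𝒢 hV hess _
    have e : Fin q ≃ V := (Fintype.equivFinOfCardEq hV).symm
    exact ⟨𝒢.relabel e, 𝒢.relabel_isEssential e hess, 𝒢.relabel_conjugate e⟩
  | succ d ih =>
    intro V _ _ _ 𝒢 hV hess hq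
    let _ : TopologicalSpace (Option V) := ⊥
    have _ : DiscreteTopology (Option V) := ⟨rfl⟩
    obtain ⟨𝒢', h1, h2, h3⟩ := 𝒢.exists_conjugate_option hess hq (by omega)
    obtain ⟨ℋ, h4, h5⟩ := ih 𝒢' (by rw [Fintype.card_option]; omega) h1 h2
    exact ⟨ℋ, h4, h3.trans h5⟩

/-- Without room every vertex has a unique successor. The successor map is onto by essentiality,
hence a permutation of a finite set, and irreducibility leaves it a single cycle. -/
theorem hasRoom_of_not_directedCycle [Fintype V] (𝒢 : SetEquippedGraph V) {q : ℕ}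
    (hess : 𝒢.graph.IsEssential) (hirr : 𝒢.graph.IsIrreducible)
    (h : ¬ (𝒢.graph.IsDirectedCycle ∧ ∃ s : V → ℕ, (∀ v, 𝒢.S v = {s v}) ∧ ∑ v, s v < q)) :
    𝒢.HasRoom q := by
  by_contra hq
  unfold HasRoom at hq
  push Not at hq
  obtain ⟨hout, hS, hsum⟩ := hq
  refine h ⟨?_, ?_⟩
  · choose f hf using fun v => (hess v).2
    have hadj : ∀ u v, 𝒢.graph.Adj u v ↔ f u = v := fun u v =>
      ⟨fun huv => by_contra fun hne => hout u _ _ hne (hf u) huv, fun e => e ▸ hf u⟩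
    have hsurj : Function.Surjective f := fun v => by
      obtain ⟨u, hu⟩ := (hess v).1
      exact ⟨u, (hadj u v).1 hu⟩
    let c : Equiv.Perm V := Equiv.ofBijective f (Finite.surjective_iff_bijective.1 hsurj)
    refine ⟨c, ⟨Set.bijOn_univ.2 c.bijective, fun x _ y _ => ?_⟩, hadj⟩
    induction hirr x y with
    | refl => exact Equiv.Perm.SameCycle.refl _ _
    | tail _ hbc ih =>
      rw [← (hadj _ _).1 hbc]
      exact Equiv.Perm.sameCycle_apply_right.2 (ih trivial)
  · choose s hs using 𝒢.nonempty
    have hs' : ∀ v, 𝒢.S v = {s v} := fun v =>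
      (𝒢.nonempty v).subset_singleton_iff.1 fun n hn => hS v n hn _ (hs v)
    exact ⟨s, hs', hsum s hs'⟩

/-! ### Counting points -/

/-- Every letter occurs in the shift of an essential graph. -/
theorem exists_mem_blockStrings_apply_zero (𝒢 : SetEquippedGraph V)
    (hess : 𝒢.graph.IsEssential) (w : V) : ∃ x ∈ 𝒢.blockStrings, x 0 = w := by
  choose m hm using 𝒢.nonempty
  -- Each vertex is paired with the starting position of its block.
  obtain ⟨f, hf0, hf⟩ := exists_int_chain (α := V × ℤ)
    (R := fun a b => 𝒢.graph.Adj a.1 b.1 ∧ b.2 = a.2 + m a.1)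
    (fun a => by
      obtain ⟨b, hb⟩ := (hess a.1).2
      exact ⟨(b, _), hb, rfl⟩)
    (fun b => by
      obtain ⟨a, ha⟩ := (hess b.1).1
      exact ⟨(a, b.2 - m a), ha, by simp⟩) (w, 0)
  have hlt : ∀ i, (f i).2 < (f (i + 1)).2 := fun i => by
    have := 𝒢.pos _ _ (hm (f i).1)
    have := (hf i).2
    omega
  have hmono : StrictMono fun i => (f i).2 := strictMono_int_of_lt_succ hlt
  choose idx h1 h2 using Int.exists_block hlt
  have hidx : ∀ i k, (f i).2 ≤ k → k < (f (i + 1)).2 → idx k = i := fun i k h3 h4 => by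
    have h5 := hmono.lt_iff_lt.1 ((h1 k).trans_lt h4)
    have h6 := hmono.lt_iff_lt.1 (h3.trans_lt (h2 k))
    omega
  refine ⟨fun k => (f (idx k)).1, ⟨fun i => (f i).1, fun i => m (f i).1, fun i => (f i).2,
    fun i => hm _, fun i => (hf i).1, fun i => (hf i).2, fun i k h3 h4 => ?_⟩, ?_⟩
  · dsimp only
    rw [hidx i k h3 h4]
  · have h3 := hlt 0
    dsimp only
    rw [hf0] at h3
    rw [hidx 0 0 (by rw [hf0]) h3, hf0]

/-- The string of a directed cycle with singletons is determined by the block at the origin, and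
by its position. -/
theorem blockStrings_finite_of_isDirectedCycle [Fintype V] (𝒢 : SetEquippedGraph V)
    (hc : 𝒢.graph.IsDirectedCycle) {s : V → ℕ} (hs : ∀ v, 𝒢.S v = {s v}) :
    𝒢.blockStrings.Finite ∧ Nat.card 𝒢.blockStrings ≤ ∑ v, s v := by
  obtain ⟨c, -, hadj⟩ := hc
  have key : ∀ x : 𝒢.blockStrings, ∃ (u : ℤ → V) (t : ℤ → ℤ), (∀ i, u (i + 1) = c (u i)) ∧
      (∀ i, t (i + 1) = t i + s (u i)) ∧ (∀ i k, t i ≤ k → k < t (i + 1) → x.1 k = u i) ∧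
      t 0 ≤ 0 ∧ 0 < t 0 + s (u 0) := by
    rintro ⟨x, u, n, t, hn, hu, ht, hx⟩
    have hn' : ∀ i, n i = s (u i) := fun i => by
      have := hn i
      rwa [hs] at this
    have hlt : ∀ i, t i < t (i + 1) := fun i => by
      have := 𝒢.pos _ _ (hn i)
      have := ht i
      omega
    obtain ⟨j, h1, h2⟩ := Int.exists_block hlt 0
    -- Reindexing makes block `0` the one that covers the origin.
    refine ⟨fun i => u (j + i), fun i => t (j + i), fun i => ?_, fun i => ?_, fun i k => ?_, ?_, ?_⟩
    · dsimp only
      rw [← add_assoc]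
      exact ((hadj _ _).1 (hu (j + i))).symm
    · dsimp only
      rw [← hn', ← add_assoc]
      exact ht (j + i)
    · simpa only [add_assoc] using hx (j + i) k
    · simpa using h1
    · rw [ht, hn'] at h2
      simpa using h2
  choose u t hu ht hx h0 h1 using key
  let F : 𝒢.blockStrings → {p // p ∈ (Finset.univ : Finset V).sigma fun v => Finset.range (s v)} :=
    fun x => ⟨⟨u x 0, (-t x 0).toNat⟩, by
      have := h0 x
      have := h1 x
      simp only [Finset.mem_sigma, Finset.mem_univ, Finset.mem_range, true_and]
      omega⟩
  have hF : Function.Injective F := fun x x' h => by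
    simp only [F, Subtype.mk.injEq, Sigma.mk.injEq, heq_eq_eq] at h
    have e : ∀ i, u x i = u x' i ∧ t x i = t x' i := fun i => by
      induction i with
      | zero =>
        have := h0 x
        have := h0 x'
        exact ⟨h.1, by omega⟩
      | succ i ih => rw [hu, hu, ht, ht, ih.1, ih.2]; exact ⟨rfl, rfl⟩
      | pred i ih =>
        have h2 := hu x (-(i : ℤ) - 1)
        have h3 := hu x' (-(i : ℤ) - 1)
        have h4 := ht x (-(i : ℤ) - 1)
        have h5 := ht x' (-(i : ℤ) - 1)
        rw [sub_add_cancel] at h2 h3 h4 h5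
        have h6 : u x (-(i : ℤ) - 1) = u x' (-(i : ℤ) - 1) :=
          c.injective (by rw [← h2, ← h3, ih.1])
        rw [h6] at h4
        have := ih.2
        exact ⟨h6, by omega⟩
    refine Subtype.ext (funext fun k => ?_)
    have hlt : ∀ i, t x i < t x (i + 1) := fun i => by
      have := 𝒢.pos (u x i) (s (u x i)) (by rw [hs]; rfl)
      have := ht x i
      omega
    obtain ⟨i, h2, h3⟩ := Int.exists_block hlt k
    rw [hx x i k h2 h3, (e i).1, hx x' i k (by rwa [← (e i).2]) (by rwa [← (e (i + 1)).2])]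
  refine ⟨Set.finite_coe_iff.1 (Finite.of_injective F hF), ?_⟩
  calc Nat.card 𝒢.blockStrings ≤ _ := Nat.card_le_card_of_injective F hF
    _ = ∑ v, s v := by
      rw [Nat.card_eq_fintype_card, Fintype.card_coe, Finset.card_sigma]
      simp only [Finset.card_range]

/-- A finite set of strings is closed, so the closure adds no points to the cycle's shift; points
with different letters at `0` are distinct on the other side. -/
theorem card_le_of_conjugate {W : Type*} [Fintype V] [TopologicalSpace V] [DiscreteTopology V]
    [Fintype W] [TopologicalSpace W] {𝒢 : SetEquippedGraph V} {ℋ : SetEquippedGraph W}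
    (hc : 𝒢.graph.IsDirectedCycle) {s : V → ℕ} (hs : ∀ v, 𝒢.S v = {s v})
    (hess : ℋ.graph.IsEssential) (h : SubshiftConjugate 𝒢.sgraphShift ℋ.sgraphShift) :
    Fintype.card W ≤ ∑ v, s v := by
  obtain ⟨φ, -⟩ := h
  obtain ⟨hfin, hcard⟩ := 𝒢.blockStrings_finite_of_isDirectedCycle hc hs
  have hcl : 𝒢.sgraphShift.carrier = 𝒢.blockStrings := hfin.isClosed.closure_eq
  have : Finite 𝒢.sgraphShift.carrier := by
    rw [hcl]
    exact hfin
  choose x hx hx0 using ℋ.exists_mem_blockStrings_apply_zero hess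
  let F : W → 𝒢.sgraphShift.carrier := fun w => φ.symm ⟨x w, subset_closure (hx w)⟩
  have hF : Function.Injective F := fun w w' h => by
    have h1 := congrArg (fun y => y.1 0) (φ.symm.injective h)
    simpa only [hx0] using h1
  calc Fintype.card W = Nat.card W := Nat.card_eq_fintype_card.symm
    _ ≤ Nat.card 𝒢.sgraphShift.carrier := Nat.card_le_card_of_injective F hF
    _ = Nat.card 𝒢.blockStrings := by rw [hcl]
    _ ≤ _ := hcard

end SetEquippedGraph

/-! ### The proposition -/

theorem mainTheorem12 {V : Type*} [Fintype V] [TopologicalSpace V] [DiscreteTopology V]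
    (p q : ℕ) (hp : 0 < p) (hpq : p < q) (hV : Fintype.card V = p)
    (𝒢 : SetEquippedGraph V) (hess : 𝒢.graph.IsEssential) (hirr : 𝒢.graph.IsIrreducible) :
    ((𝒢.graph.IsDirectedCycle ∧ ∃ s : V → ℕ, (∀ v, 𝒢.S v = {s v}) ∧ ∑ v, s v < q) →
      ¬ ∃ ℋ : SetEquippedGraph (Fin q), ℋ.graph.IsEssential ∧
        SubshiftConjugate 𝒢.sgraphShift ℋ.sgraphShift) ∧
    (¬ (𝒢.graph.IsDirectedCycle ∧ ∃ s : V → ℕ, (∀ v, 𝒢.S v = {s v}) ∧ ∑ v, s v < q) →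
      ∃ ℋ : SetEquippedGraph (Fin q), ℋ.graph.IsEssential ∧
        SubshiftConjugate 𝒢.sgraphShift ℋ.sgraphShift) := by
  refine ⟨?_, fun h => ?_⟩
  · rintro ⟨hc, s, hs, hsum⟩ ⟨ℋ, hℋ, hconj⟩
    have := SetEquippedGraph.card_le_of_conjugate hc hs hℋ hconj
    rw [Fintype.card_fin] at this
    omega
  · exact SetEquippedGraph.exists_conjugate_fin (q - p) 𝒢 (by omega) hess
      (𝒢.hasRoom_of_not_directedCycle hess hirr h)
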